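/- Let $m\in\mathbb N$, let $U\subseteq\mathbb R^m$ be open (for instance $U=\mathbb R^m$), and let $\mathcal H^1$ be the one-dimensional Hausdorff measure. A 1-current in $U$ is a continuous linear functional on the space of smooth 1-forms with compact support in $U$. A 1-current $T$ is (real) rectifiable, written $T=\underline{\underline{\tau}}(M,\theta,\xi)$, if $$T(\omega)=\int_M\langle\omega(x),\xi(x)\rangle\,\theta(x)\,d\mathcal H^1(x)\qquad\text{for all }\omega,$$ where $M\subseteq U$ is $\mathcal H^1$-measurable and countably 1-rectifiable (covered, up to an $\mathcal H^1$-null set, by countably many Lipschitz images of $\mathbb R$), $\theta>0$ on $M$ is locally $\mathcal H^1$-integrable in $U$, and $\xi$ is an $\mathcal H^1$-measurable field of unit vectors on $M$ which for $\mathcal H^1$-a.e. $x\in M$ spans the approximate tangent line of $M$ at $x$, i.e. with $P=\mathbb R\,\xi(x)$, $$\lim_{\lambda\downarrow0}\lambda^{-1}\int_M f\big(\lambda^{-1}(y-x)\big)\theta(y)\,d\mathcal H^1(y)=\theta(x)\int_P f\,d\mathcal H^1\qquad\text{for all }f\in C_c(\mathbb R^m).$$ For $c>0$ and $\alpha\in[0,1]$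 put $$H_{c,\alpha}(x)=\Big\lfloor\frac xc\Big\rfloor+\Big(\frac xc-\Big\lfloor\frac xc\Big\rfloor\Big)^{\alpha}$$ with the convention $0^\alpha=0$ also for $\alpha=0$ (so $H_{c,\alpha}(nc)=n$ for integers $n$), and for $T=\underline{\underline{\tau}}(M,\theta,\xi)$ define $$\mathbf M_{\alpha,c}(T)=c^\alpha\int_M H_{c,\alpha}(\theta(x))\,d\mathcal H^1(x)\in[0,\infty].$$ **Proposition.** Let $c>0$ and $\alpha\in[0,1]$. The value $\mathbf M_{\alpha,c}(T)$ does not depend on the triple $(M,\theta,\xi)$ representing the rectifiable 1-current $T$. For any two rectifiable 1-currents $T_1,T_2$ in $U$, the sum $T_1+T_2$ is again a rectifiable 1-current, and $$\mathbf M_{\alpha,c}(T_1+T_2)\le\mathbf M_{\alpha,c}(T_1)+\mathbf M_{\alpha,c}(T_2).$$ -/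

import Mathlib

open MeasureTheory Set Filter TopologicalSpace
open scoped Topology ENNReal Distributions

noncomputable section

/-- The space `𝒟₁(U)` of `1`-currents in an open set `U ⊆ ℝᵐ`: continuous linear functionals on the
space of smooth `1`-forms with compact support in `U`, with its usual (LF) topology. -/
abbrev OneCurrent {m : ℕ} (U : Opens (EuclideanSpace ℝ (Fin m))) : Type :=
  𝓓(U, EuclideanSpace ℝ (Fin m) →L[ℝ] ℝ) →L[ℝ] ℝ

/-- `M` is countably `1`-rectifiable: up to an `ℋ¹`-null set it is covered by countably many
Lipschitz images of `ℝ`. -/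
def CountablyOneRectifiable {m : ℕ} (M : Set (EuclideanSpace ℝ (Fin m))) : Prop :=
  ∃ (M₀ : Set (EuclideanSpace ℝ (Fin m))) (F : ℕ → ℝ → EuclideanSpace ℝ (Fin m)),
    Measure.hausdorffMeasure 1 M₀ = 0 ∧ (∀ j, ∃ K, LipschitzWith K (F j)) ∧
      M ⊆ M₀ ∪ ⋃ j, range (F j)

/-- The line `P` is the approximate tangent line of `M` at `x` with respect to the multiplicity
function `θ`: for all continuous `f` with compact support,
`λ⁻¹ ∫_M f (λ⁻¹ (y - x)) θ(y) dℋ¹(y) → θ(x) ∫_P f dℋ¹` as `λ ↓ 0`. -/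
def IsApproxTangentLine {m : ℕ} (M : Set (EuclideanSpace ℝ (Fin m)))
    (θ : EuclideanSpace ℝ (Fin m) → ℝ) (x : EuclideanSpace ℝ (Fin m))
    (P : Submodule ℝ (EuclideanSpace ℝ (Fin m))) : Prop :=
  Module.finrank ℝ P = 1 ∧
    ∀ f : EuclideanSpace ℝ (Fin m) → ℝ, Continuous f → HasCompactSupport f →
      Tendsto
        (fun l : ℝ => l⁻¹ * ∫ y in M, f (l⁻¹ • (y - x)) * θ y ∂(Measure.hausdorffMeasure 1))
        (𝓝[>] 0)
        (𝓝 (θ x * ∫ y in (P : Set (EuclideanSpace ℝ (Fin m))), f y ∂(Measure.hausdorffMeasure 1)))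

/-- The data `(M, θ, ξ)` of a (real multiplicity) rectifiable `1`-current in `U`: an
`ℋ¹`-measurable countably `1`-rectifiable set `M ⊆ U`, a positive locally `ℋ¹`-integrable
multiplicity `θ` on `M`, and an `ℋ¹`-measurable field `ξ` of unit vectors on `M` which spans the
approximate tangent line of `M` almost everywhere. Only the values of `θ` and `ξ` on `M` matter. -/
structure RectifiableTriple {m : ℕ} (U : Opens (EuclideanSpace ℝ (Fin m))) where
  M : Set (EuclideanSpace ℝ (Fin m))
  θ : EuclideanSpace ℝ (Fin m) → ℝ
  ξ : EuclideanSpace ℝ (Fin m) → EuclideanSpace ℝ (Fin m)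
  subset : M ⊆ U
  nullMeasurableSet : NullMeasurableSet M (Measure.hausdorffMeasure 1)
  rectifiable : CountablyOneRectifiable M
  pos : ∀ x ∈ M, 0 < θ x
  locallyIntegrableOn :
    LocallyIntegrableOn θ (U : Set (EuclideanSpace ℝ (Fin m)))
      ((Measure.hausdorffMeasure 1).restrict M)
  aemeasurable : AEMeasurable ξ ((Measure.hausdorffMeasure 1).restrict M)
  tangent : ∀ᵐ x ∂((Measure.hausdorffMeasure 1).restrict M),
    ‖ξ x‖ = 1 ∧ IsApproxTangentLine M θ x (Submodule.span ℝ {ξ x})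

/-- `T = τ(M, θ, ξ)`, that is, `T(ω) = ∫_M ⟨ω(x), ξ(x)⟩ θ(x) dℋ¹(x)` for every `1`-form `ω`. -/
def RectifiableTriple.Represents {m : ℕ} {U : Opens (EuclideanSpace ℝ (Fin m))}
    (R : RectifiableTriple U) (T : OneCurrent U) : Prop :=
  ∀ ω : 𝓓(U, EuclideanSpace ℝ (Fin m) →L[ℝ] ℝ),
    T ω = ∫ x in R.M, ω x (R.ξ x) * R.θ x ∂(Measure.hausdorffMeasure 1)

/-- `T` is a rectifiable `1`-current. -/
def IsRectifiableCurrent {m : ℕ} {U : Opens (EuclideanSpace ℝ (Fin m))}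
    (T : OneCurrent U) : Prop :=
  ∃ R : RectifiableTriple U, R.Represents T

/-- `H_{c,α}(x) = ⌊x/c⌋ + (x/c - ⌊x/c⌋)^α`, where `0^α = 0` also for `α = 0`
(so that `H_{c,α}(n c) = n` for all integers `n`). -/
def capacityH (c α x : ℝ) : ℝ :=
  (⌊x / c⌋ : ℝ) + if Int.fract (x / c) = 0 then 0 else Int.fract (x / c) ^ α

/-- The transport cost `c^α ∫_M H_{c,α}(θ(x)) dℋ¹(x) ∈ [0, ∞]` computed from a triple. -/
def RectifiableTriple.cost {m : ℕ} {U : Opens (EuclideanSpace ℝ (Fin m))}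
    (R : RectifiableTriple U) (α c : ℝ) : ℝ≥0∞ :=
  ENNReal.ofReal (c ^ α) *
    ∫⁻ x in R.M, ENNReal.ofReal (capacityH c α (R.θ x)) ∂(Measure.hausdorffMeasure 1)

/-- The transport cost `𝐌_{α,c}(T) ∈ [0, ∞]` of a `1`-current: the common value of the costs of the
triples `(M, θ, ξ)` with `T = τ(M, θ, ξ)`, written as an infimum (so `∞` if there are none). That
all these triples have the same cost is asserted in the theorem. -/
def capacityCost {m : ℕ} {U : Opens (EuclideanSpace ℝ (Fin m))} (α c : ℝ)
    (T : OneCurrent U) : ℝ≥0∞ :=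
  ⨅ (R : RectifiableTriple U) (_ : R.Represents T), R.cost α c

end

/-! A triple is encoded by one vector field, its density `F = θ ξ` on `M`, extended by zero. The
current is `ω ↦ ∫ ω(F) dℋ¹`, so the fundamental lemma of the calculus of variations determines `F`
up to `ℋ¹`-null sets. Since `H(0) = 0`, the cost is `c^α ∫ H(‖F‖) dℋ¹`, hence independent of the
triple.

For a sum with densities `F` and `G` the candidate density is `F + G`, and the only delicate point
is its approximate tangent line. By Lebesgue differentiation relative to the measure `‖F‖ ℋ¹`, at
almost every point where `F ≠ 0` the blow-ups of any locally integrable `g` have the limit shape of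
those of `‖F‖`, scaled by `g(x)` (`ae_tendsto_blowup_of_density`). Comparing `‖F‖` with `‖G‖` shows
that the two lines agree where both densities are nonzero; taking `g = ‖F + G‖` then gives the
tangent line of the sum.

The cost inequality is pointwise: `‖F + G‖ ≤ ‖F‖ + ‖G‖`, and `H` is monotone and subadditive. -/

/-! ### Monotonicity and subadditivity of the cost function -/

theorem capacityH_zero (c α : ℝ) : capacityH c α 0 = 0 := by simp [capacityH]

theorem measurable_capacityH (c α : ℝ) : Measurable (capacityH c α) := by
  unfold capacityH
  have hf : Measurable fun x : ℝ => Int.fract (x / c) := by fun_prop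
  refine Measurable.add ?_ (Measurable.ite (hf (measurableSet_singleton 0)) measurable_const ?_)
  · have : Measurable fun x : ℝ => ⌊x / c⌋ := by fun_prop
    exact measurable_from_top.comp this
  · exact hf.pow_const α

theorem rpow_fract_mem_Icc {α x : ℝ} (hα : 0 ≤ α) :
    (if Int.fract x = 0 then 0 else Int.fract x ^ α) ∈ Icc (0 : ℝ) 1 := by
  split_ifs
  · simp
  · exact ⟨Real.rpow_nonneg (Int.fract_nonneg x) α,
      Real.rpow_le_one (Int.fract_nonneg x) (Int.fract_lt_one x).le hα⟩

/-- The fractional term stays in `[0, 1]`, so a jump of the floor by at least one pays for any drop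
in it; with equal floors only the monotonicity of the power is needed. -/
theorem capacityH_mono {c α : ℝ} (hc : 0 < c) (hα : 0 ≤ α) : Monotone (capacityH c α) := by
  intro x y hxy
  have h : x / c ≤ y / c := by gcongr
  unfold capacityH
  generalize x / c = a, y / c = b at h
  rcases (Int.floor_le_floor h).lt_or_eq with hlt | heq
  · have h1 : ((⌊a⌋ : ℤ) : ℝ) + 1 ≤ ⌊b⌋ := by exact_mod_cast hlt
    have := (rpow_fract_mem_Icc (x := a) hα).2
    have := (rpow_fract_mem_Icc (x := b) hα).1
    linarith
  · have hfr : Int.fract a ≤ Int.fract b := by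
      unfold Int.fract
      rw [heq]
      linarith
    rw [heq]
    gcongr
    by_cases ha : Int.fract a = 0
    · simpa [ha] using (rpow_fract_mem_Icc (x := b) hα).1
    · have hpos : 0 < Int.fract a := lt_of_le_of_ne (Int.fract_nonneg a) (Ne.symm ha)
      rw [if_neg ha, if_neg (hpos.trans_le hfr).ne']
      exact Real.rpow_le_rpow hpos.le hfr hα

/-- Concavity: `s` and `t` lie between `s + t - 1` and `1` and have the same sum as these endpoints.
They are convex combinations of them with swapped weights, so the two concavity inequalities add up.
-/
theorem one_add_rpow_le_rpow_add_rpow {α s t : ℝ} (hα : α ∈ Icc (0 : ℝ) 1) (hs : s ≤ 1)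
    (ht : t ≤ 1) (hst : 1 ≤ s + t) : 1 + (s + t - 1) ^ α ≤ s ^ α + t ^ α := by
  rcases (show s + t - 1 ≤ 1 by linarith).lt_or_eq with hu | hu
  · have key := (Real.concaveOn_rpow hα.1 hα.2).2 (x := 1) (y := s + t - 1) (by simp)
      (by simp only [mem_Ici]; linarith)
    have hd : 0 < 2 - s - t := by linarith
    have h1 := key (a := (1 - t) / (2 - s - t)) (b := (1 - s) / (2 - s - t))
      (div_nonneg (by linarith) hd.le) (div_nonneg (by linarith) hd.le) (by field_simp; ring)
    have h2 := key (a := (1 - s) / (2 - s - t)) (b := (1 - t) / (2 - s - t))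
      (div_nonneg (by linarith) hd.le) (div_nonneg (by linarith) hd.le) (by field_simp; ring)
    have e1 : (1 - t) / (2 - s - t) * 1 + (1 - s) / (2 - s - t) * (s + t - 1) = s := by
      field_simp; ring
    have e2 : (1 - s) / (2 - s - t) * 1 + (1 - t) / (2 - s - t) * (s + t - 1) = t := by
      field_simp; ring
    simp only [smul_eq_mul, Real.one_rpow] at h1 h2
    rw [e1] at h1
    rw [e2] at h2
    have e3 : (1 - s) / (2 - s - t) = 1 - (1 - t) / (2 - s - t) := by field_simp; ring
    rw [e3] at h1 h2
    linarith
  · obtain rfl : s = 1 := by linarith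
    obtain rfl : t = 1 := by linarith
    norm_num

/-- Either the fractional parts do not carry, and `t ↦ t ^ α` is subadditive, or they carry one
unit, and `one_add_rpow_le_rpow_add_rpow` applies. -/
theorem capacityH_add_le {c α : ℝ} (hα : α ∈ Icc (0 : ℝ) 1) (x y : ℝ) :
    capacityH c α (x + y) ≤ capacityH c α x + capacityH c α y := by
  unfold capacityH
  rw [add_div]
  generalize x / c = a, y / c = b
  have hs0 := Int.fract_nonneg a
  have hs1 := Int.fract_lt_one a
  have ht0 := Int.fract_nonneg b
  have ht1 := Int.fract_lt_one b
  have ea := Int.floor_add_fract a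
  have eb := Int.floor_add_fract b
  rcases lt_or_ge (Int.fract a + Int.fract b) 1 with h | h
  · have hfl : ⌊a + b⌋ = ⌊a⌋ + ⌊b⌋ := by
      rw [Int.floor_eq_iff]; push_cast; constructor <;> linarith
    have hfr : Int.fract (a + b) = Int.fract a + Int.fract b := by
      unfold Int.fract; rw [hfl]; push_cast; ring
    rw [hfl, hfr]
    push_cast
    by_cases ha : Int.fract a = 0
    · simp only [ha, zero_add, if_true]; linarith
    by_cases hb : Int.fract b = 0
    · simp only [hb, add_zero, if_true]; linarith
    have ha' : 0 < Int.fract a := lt_of_le_of_ne hs0 (Ne.symm ha)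
    rw [if_neg ha, if_neg hb, if_neg (by linarith)]
    have := Real.rpow_add_le_add_rpow hs0 ht0 hα.1 hα.2
    linarith
  · have hfl : ⌊a + b⌋ = ⌊a⌋ + ⌊b⌋ + 1 := by
      rw [Int.floor_eq_iff]; push_cast; constructor <;> linarith
    have hfr : Int.fract (a + b) = Int.fract a + Int.fract b - 1 := by
      unfold Int.fract; rw [hfl]; push_cast; ring
    have key := one_add_rpow_le_rpow_add_rpow hα hs1.le ht1.le h
    -- For `α = 0` the two conventions for `0 ^ α` differ; the one in `capacityH` is the smaller,
    -- which is the direction needed.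
    have hle : (if Int.fract a + Int.fract b - 1 = 0 then (0 : ℝ)
        else (Int.fract a + Int.fract b - 1) ^ α) ≤ (Int.fract a + Int.fract b - 1) ^ α := by
      split_ifs
      · exact Real.rpow_nonneg (by linarith) α
      · exact le_rfl
    rw [hfl, hfr, if_neg (by linarith : ¬ Int.fract a = 0), if_neg (by linarith : ¬ Int.fract b = 0)]
    push_cast
    linarith

/-! ### Differentiation and blow-ups relative to a density -/

theorem withDensity_ofReal_toReal_apply {X : Type*} [MeasurableSpace X] {μ : Measure X}
    {ψ : X → ℝ} (hψ : Integrable ψ μ) (h0 : ∀ x, 0 ≤ ψ x) {s : Set X} (hs : MeasurableSet s) :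
    ((μ.withDensity fun x => ENNReal.ofReal (ψ x)) s).toReal = ∫ x in s, ψ x ∂μ := by
  rw [withDensity_apply _ hs, ← ofReal_integral_eq_lintegral_ofReal hψ.integrableOn
    (ae_of_all _ h0), ENNReal.toReal_ofReal (integral_nonneg h0)]

theorem HasCompactSupport.exists_pos_forall_norm_le {E : Type*} [NormedAddCommGroup E]
    {f : E → ℝ} (hf : HasCompactSupport f) :
    ∃ R > 0, ∀ z, f z ≠ 0 → ‖z‖ ≤ R := by
  obtain ⟨R, hR, hsub⟩ := hf.isCompact.isBounded.subset_closedBall_lt 0 0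
  exact ⟨R, hR, fun z hz => by simpa using hsub (subset_tsupport f hz)⟩

theorem norm_le_mul_of_inv_smul_sub {E : Type*} [NormedAddCommGroup E] [NormedSpace ℝ E]
    {R l : ℝ} (hl : 0 < l) {x y : E}
    (h : ‖l⁻¹ • (y - x)‖ ≤ R) : y ∈ Metric.closedBall x (l * R) := by
  rw [norm_smul, norm_inv, Real.norm_of_nonneg hl.le, inv_mul_le_iff₀ hl] at h
  rwa [Metric.mem_closedBall, dist_eq_norm]

theorem integrable_comp_inv_smul_sub_mul {E : Type*} [NormedAddCommGroup E] [NormedSpace ℝ E]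
    [MeasurableSpace E] [BorelSpace E] {μ : Measure E} {f g : E → ℝ} (hf : Continuous f)
    (hfc : HasCompactSupport f) {R l : ℝ} (hl : 0 < l) (hR : ∀ z, f z ≠ 0 → ‖z‖ ≤ R) {x : E}
    (hg : IntegrableOn g (Metric.closedBall x (l * R)) μ) :
    Integrable (fun y => f (l⁻¹ • (y - x)) * g y) μ := by
  obtain ⟨C, hC⟩ := hf.bounded_above_of_compact_support hfc
  have hcont : Continuous fun y => f (l⁻¹ • (y - x)) := by fun_prop
  have hi : IntegrableOn (fun y => f (l⁻¹ • (y - x)) * g y) (Metric.closedBall x (l * R)) μ :=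
    Integrable.bdd_mul (c := C) hg hcont.aestronglyMeasurable (ae_of_all _ fun y => hC _)
  refine (integrableOn_iff_integrable_of_support_subset fun y hy => ?_).1 hi
  exact norm_le_mul_of_inv_smul_sub hl (hR _ (left_ne_zero_of_mul hy))

section Differentiation

variable {E : Type*} [NormedAddCommGroup E] [NormedSpace ℝ E] [FiniteDimensional ℝ E]
  [MeasurableSpace E] [BorelSpace E]

/-- Lebesgue differentiation of `g` relative to a nonnegative density `ψ`. -/
theorem ae_isLittleO_setIntegral_sub_smul {μ : Measure E} {ψ g : E → ℝ} (hψ : Integrable ψ μ)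
    (h0 : ∀ x, 0 ≤ ψ x) (hg : Integrable g μ) :
    ∀ᵐ x ∂μ, 0 < ψ x →
      (fun r => ∫ y in Metric.closedBall x r, |g y - g x / ψ x * ψ y| ∂μ) =o[𝓝[>] 0]
        fun r => ∫ y in Metric.closedBall x r, ψ y ∂μ := by
  have : ProperSpace E := FiniteDimensional.proper ℝ E
  have hψm : AEMeasurable (fun x => ENNReal.ofReal (ψ x)) μ := hψ.aemeasurable.ennreal_ofReal
  have hZ : NullMeasurableSet {x | ψ x = 0} μ :=
    hψ.aemeasurable.nullMeasurableSet_preimage (measurableSet_singleton 0)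
  -- Lebesgue decomposition of `g μ` relative to `ν = ψ μ`: `k` carries the mass of `|g|` on `{ψ =
  -- 0}`, singular to `ν`; the rest has `ν`-density `g / ψ`. Passing to the finite measure `ν`
  -- avoids any σ-finiteness of `μ`.
  set k : E → ℝ := {x | ψ x = 0}.indicator fun x => |g x| with hk
  have hk0 : ∀ x, 0 ≤ k x := fun x => indicator_nonneg (fun _ _ => abs_nonneg _) x
  have hki : Integrable k μ := hg.abs.integrableOn.integrable_indicator₀ hZ
  set ν := μ.withDensity fun x => ENNReal.ofReal (ψ x) with hν
  set ρ := μ.withDensity fun x => ENNReal.ofReal (k x) with hρ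
  have : IsFiniteMeasure ν := isFiniteMeasure_withDensity_ofReal hψ.2
  have : IsFiniteMeasure ρ := isFiniteMeasure_withDensity_ofReal hki.2
  have hsing : ρ ⟂ₘ ν := by
    refine Measure.MutuallySingular.mk (s := {x | ψ x ≠ 0}) (t := {x | ψ x = 0}) ?_ ?_ ?_
    · rw [hρ, withDensity_apply_eq_zero' hki.aemeasurable.ennreal_ofReal]
      convert measure_empty (μ := μ)
      ext x
      by_cases hx : ψ x = 0 <;> simp [hk, hx]
    · rw [hν, withDensity_apply_eq_zero' hψm]
      convert measure_empty (μ := μ)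
      ext x
      by_cases hx : ψ x = 0 <;> simp [hx]
    · intro x _
      exact (ne_or_eq (ψ x) 0)
  have htop : ∀ᵐ x ∂μ, ENNReal.ofReal (ψ x) < ∞ := ae_of_all _ fun _ => ENNReal.ofReal_lt_top
  set h : E → ℝ := fun x => g x / ψ x with hh
  have hhi : Integrable h ν := by
    rw [hν, integrable_withDensity_iff_integrable_smul₀' hψm htop]
    refine hg.mono ?_ (ae_of_all _ fun x => ?_)
    · exact (hψm.ennreal_toReal.mul
        (hg.aemeasurable.div hψ.aemeasurable)).aestronglyMeasurable
    · rw [ENNReal.toReal_ofReal (h0 x), smul_eq_mul, hh]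
      by_cases hx : ψ x = 0
      · simp [hx]
      · rw [mul_div_cancel₀ _ hx]
  have A := (Besicovitch.vitaliFamily ν).ae_tendsto_average_norm_sub hhi.locallyIntegrable
  have B := (Besicovitch.vitaliFamily ν).ae_eventually_measure_zero_of_singular hsing
  have C := (Besicovitch.vitaliFamily ν).ae_eventually_measure_pos
  have D := (ae_withDensity_iff' hψm).1 (A.and (B.and C))
  filter_upwards [D] with x hx hpos
  obtain ⟨hA, hB, hC⟩ := hx (by simpa using hpos)
  have hb := Besicovitch.tendsto_filterAt ν x
  replace hA := hA.comp hb
  replace hB := (ENNReal.tendsto_toReal ENNReal.zero_ne_top).comp (hB.comp hb)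
  replace hC := hb.eventually hC
  have hden : ∀ r, (ν (Metric.closedBall x r)).toReal = ∫ y in Metric.closedBall x r, ψ y ∂μ :=
    fun r => withDensity_ofReal_toReal_apply hψ h0 measurableSet_closedBall
  rw [Asymptotics.isLittleO_iff_tendsto']
  · have hsum := hA.add hB
    simp only [ENNReal.toReal_zero, add_zero] at hsum
    refine hsum.congr fun r => ?_
    have hms : MeasurableSet (Metric.closedBall x r) := measurableSet_closedBall
    simp only [Function.comp_apply, ENNReal.toReal_div]
    rw [setAverage_eq, measureReal_def, hden, hρ, withDensity_ofReal_toReal_apply hki hk0 hms, hν,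
      setIntegral_withDensity_eq_setIntegral_toReal_smul₀ hψm.restrict (ae_restrict_of_ae htop) _
        hms, smul_eq_mul, inv_mul_eq_div, ← add_div, ← integral_add]
    · congr 1
      refine integral_congr_ae (ae_of_all _ fun y => ?_)
      simp only [smul_eq_mul, ENNReal.toReal_ofReal (h0 y), hk, hh, Real.norm_eq_abs]
      by_cases hy : ψ y = 0
      · simp [hy]
      · rw [indicator_of_notMem (by simpa using hy), add_zero]
        nth_rewrite 1 [← abs_of_nonneg (h0 y)]
        rw [← abs_mul, mul_sub, mul_div_cancel₀ _ hy, mul_comm (ψ y)]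
    · have := (hhi.sub (integrable_const (h x))).norm
      rw [hν, integrable_withDensity_iff_integrable_smul₀' hψm htop] at this
      exact this.integrableOn
    · exact hki.integrableOn
  · filter_upwards [hC] with r hr h1
    rw [← hden] at h1
    exact absurd h1 (ENNReal.toReal_pos hr.ne' (measure_ne_top _ _)).ne'

/-- Blow-up limits of a nonnegative density `ψ` determine those of any locally integrable `g`
at almost every point where `ψ` is positive. -/
theorem ae_tendsto_blowup_of_density {μ : Measure E} {U : Set E} (hU : IsOpen U) {ψ g : E → ℝ}
    (hψ : LocallyIntegrableOn ψ U μ) (h0 : ∀ x, 0 ≤ ψ x) (hg : LocallyIntegrableOn g U μ) :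
    ∀ᵐ x ∂μ, x ∈ U → 0 < ψ x → ∀ L : (E → ℝ) → ℝ,
      (∀ f : E → ℝ, Continuous f → HasCompactSupport f →
        Tendsto (fun l : ℝ => l⁻¹ * ∫ y, f (l⁻¹ • (y - x)) * ψ y ∂μ) (𝓝[>] 0) (𝓝 (ψ x * L f))) →
      ∀ f : E → ℝ, Continuous f → HasCompactSupport f →
        Tendsto (fun l : ℝ => l⁻¹ * ∫ y, f (l⁻¹ • (y - x)) * g y ∂μ) (𝓝[>] 0)
          (𝓝 (g x * L f)) := by
  have : ProperSpace E := FiniteDimensional.proper ℝ E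
  -- Countably many open sets on which `ψ` and `g` are integrable reduce the local statement to the
  -- integrable one, with a single exceptional null set.
  obtain ⟨u, huo, hUu, hui⟩ := hψ.exists_nat_integrableOn
  obtain ⟨v, hvo, hUv, hvi⟩ := hg.exists_nat_integrableOn
  have key : ∀ᵐ x ∂μ, ∀ n k, x ∈ u n ∩ v k ∩ U → 0 < ψ x →
      (fun r => ∫ y in Metric.closedBall x r, |g y - g x / ψ x * ψ y| ∂μ.restrict (u n ∩ v k ∩ U))
        =o[𝓝[>] 0] fun r => ∫ y in Metric.closedBall x r, ψ y ∂μ.restrict (u n ∩ v k ∩ U) := by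
    refine ae_all_iff.2 fun n => ae_all_iff.2 fun k => ?_
    have hm : MeasurableSet (u n ∩ v k ∩ U) := (((huo n).inter (hvo k)).inter hU).measurableSet
    rw [← ae_restrict_iff' hm]
    exact ae_isLittleO_setIntegral_sub_smul
      ((hui n).mono_set (inter_subset_inter_left _ inter_subset_left)) h0
      ((hvi k).mono_set (inter_subset_inter_left _ inter_subset_right))
  filter_upwards [key] with x hx hxU hpos L hL f hf hfc
  obtain ⟨n, hn⟩ := mem_iUnion.1 (hUu hxU)
  obtain ⟨k, hk⟩ := mem_iUnion.1 (hUv hxU)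
  specialize hx n k ⟨⟨hn, hk⟩, hxU⟩ hpos
  set V := u n ∩ v k ∩ U with hV
  have hVo : IsOpen V := ((huo n).inter (hvo k)).inter hU
  have hψV : IntegrableOn ψ V μ :=
    (hui n).mono_set (inter_subset_inter_left _ inter_subset_left)
  have hgV : IntegrableOn g V μ :=
    (hvi k).mono_set (inter_subset_inter_left _ inter_subset_right)
  obtain ⟨R, hR, hfR⟩ := hfc.exists_pos_forall_norm_le
  obtain ⟨C, hC⟩ := hf.bounded_above_of_compact_support hfc
  set q := g x / ψ x with hq
  obtain ⟨ε, hε, hεV⟩ := Metric.isOpen_iff.1 hVo x ⟨⟨hn, hk⟩, hxU⟩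
  have hpos' : ∀ᶠ l : ℝ in 𝓝[>] 0, 0 < l := eventually_mem_nhdsWithin
  have hsmall : ∀ᶠ l : ℝ in 𝓝[>] 0, Metric.closedBall x (l * (R + 1)) ⊆ V := by
    have : ∀ᶠ l : ℝ in 𝓝[>] 0, l * (R + 1) < ε := by
      have h1 : Tendsto (fun l : ℝ => l * (R + 1)) (𝓝[>] 0) (𝓝 0) := by
        have : Continuous fun l : ℝ => l * (R + 1) := by fun_prop
        simpa using (this.tendsto 0).mono_left nhdsWithin_le_nhds
      exact h1.eventually (gt_mem_nhds hε)
    filter_upwards [this] with l hl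
    exact (Metric.closedBall_subset_ball hl).trans hεV
  have hsmall' : ∀ᶠ l : ℝ in 𝓝[>] 0, Metric.closedBall x (l * R) ⊆ V := by
    filter_upwards [hsmall, hpos'] with l hl hl0
    refine (Metric.closedBall_subset_closedBall ?_).trans hl
    nlinarith
  -- A cutoff equal to `1` on the ball of radius `R`: the assumed convergence for this test function
  -- bounds the `ψ`-mass of the ball of radius `l * R` by `O(l)`.
  set bump : E → ℝ := fun z => max 0 (min 1 (R + 1 - ‖z‖)) with hbump
  have hbc : Continuous bump := by fun_prop
  have hb0 : ∀ z, 0 ≤ bump z := fun z => le_max_left _ _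
  have hbR : ∀ z, bump z ≠ 0 → ‖z‖ ≤ R + 1 := by
    intro z hz
    by_contra! hlt
    exact hz (max_eq_left ((min_le_right _ _).trans (by linarith)))
  have hb1 : ∀ z, ‖z‖ ≤ R → bump z = 1 := by
    intro z hz
    simp only [hbump]
    rw [min_eq_left (by linarith), max_eq_right zero_le_one]
  have hbcs : HasCompactSupport bump :=
    HasCompactSupport.of_support_subset_isCompact (isCompact_closedBall (0 : E) (R + 1))
      fun z hz => by simpa using hbR z hz
  have hscale : Tendsto (fun l : ℝ => l * R) (𝓝[>] 0) (𝓝[>] 0) := by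
    refine tendsto_nhdsWithin_iff.2 ⟨?_, ?_⟩
    · have : Continuous fun l : ℝ => l * R := by fun_prop
      simpa using (this.tendsto 0).mono_left nhdsWithin_le_nhds
    · filter_upwards [hpos'] with l hl using mul_pos hl hR
  have hlo := (Asymptotics.isBigO_refl (fun l : ℝ => l⁻¹) (𝓝[>] 0)).mul_isLittleO
    (hx.comp_tendsto hscale)
  have hrestr : ∀ l, Metric.closedBall x (l * R) ⊆ V →
      (μ.restrict V).restrict (Metric.closedBall x (l * R)) =
        μ.restrict (Metric.closedBall x (l * R)) := fun l hl => by
    rw [Measure.restrict_restrict measurableSet_closedBall, inter_eq_left.2 hl]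
  have hbig : (fun l : ℝ => l⁻¹ *
      ((fun r => ∫ y in Metric.closedBall x r, ψ y ∂μ.restrict V) ∘ fun l => l * R) l)
      =O[𝓝[>] 0] fun _ => (1 : ℝ) := by
    refine Asymptotics.IsBigO.trans ?_ ((hL bump hbc hbcs).isBigO_one ℝ)
    refine Asymptotics.IsBigO.of_bound 1 ?_
    filter_upwards [hpos', hsmall, hsmall'] with l hl hlV hlV'
    rw [one_mul, Function.comp_apply, hrestr l hlV', norm_mul, norm_mul]
    gcongr
    rw [Real.norm_of_nonneg (integral_nonneg fun y => h0 y),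
      Real.norm_of_nonneg (integral_nonneg fun y => mul_nonneg (hb0 _) (h0 y)),
      ← integral_indicator measurableSet_closedBall]
    refine integral_mono_of_nonneg (ae_of_all _ fun y => indicator_nonneg (fun _ _ => h0 _) y)
      (integrable_comp_inv_smul_sub_mul hbc hbcs hl hbR (hψV.mono_set hlV))
      (ae_of_all _ fun y => ?_)
    by_cases hy : y ∈ Metric.closedBall x (l * R)
    · simp only [indicator_of_mem hy]
      rw [hb1, one_mul]
      rw [norm_smul, norm_inv, Real.norm_of_nonneg hl.le, inv_mul_le_iff₀ hl, ← dist_eq_norm]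
      exact hy
    · simp only [indicator_of_notMem hy]
      exact mul_nonneg (hb0 _) (h0 y)
  -- The error is at most `C / l` times the integral of `|g - q ψ|` over the ball of radius `l * R`,
  -- which is `o` of its `ψ`-mass, hence `o(l)`.
  have hdiff : Tendsto (fun l : ℝ => l⁻¹ * ∫ y, f (l⁻¹ • (y - x)) * (g y - q * ψ y) ∂μ)
      (𝓝[>] 0) (𝓝 0) := by
    rw [← Asymptotics.isLittleO_one_iff ℝ]
    refine Asymptotics.IsBigO.trans_isLittleO ?_ (hlo.trans_isBigO hbig)
    refine Asymptotics.IsBigO.of_bound C ?_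
    filter_upwards [hpos', hsmall'] with l hl hlV
    rw [Function.comp_apply, hrestr l hlV, norm_mul, norm_mul, mul_left_comm]
    gcongr
    rw [Real.norm_of_nonneg (integral_nonneg fun y => abs_nonneg (g y - g x / ψ x * ψ y)),
      ← integral_const_mul, ← integral_indicator measurableSet_closedBall]
    have hint : IntegrableOn (fun y => g y - q * ψ y) (Metric.closedBall x (l * R)) μ :=
      (hgV.mono_set hlV).sub ((hψV.mono_set hlV).const_mul q)
    refine norm_integral_le_of_norm_le
      (IntegrableOn.integrable_indicator (hint.abs.const_mul C) measurableSet_closedBall)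
      (ae_of_all _ fun y => ?_)
    by_cases hy : f (l⁻¹ • (y - x)) = 0
    · rw [hy, zero_mul, norm_zero]
      exact indicator_nonneg (fun _ _ => mul_nonneg ((norm_nonneg _).trans (hC 0))
        (abs_nonneg _)) y
    · rw [indicator_of_mem (norm_le_mul_of_inv_smul_sub hl (hfR _ hy)), norm_mul,
        Real.norm_eq_abs (g y - q * ψ y)]
      exact mul_le_mul_of_nonneg_right (hC _) (abs_nonneg _)
  have hlim := hdiff.add ((hL f hf hfc).const_mul q)
  rw [zero_add, ← mul_assoc, hq, div_mul_cancel₀ _ hpos.ne'] at hlim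
  refine hlim.congr' ?_
  filter_upwards [hpos', hsmall'] with l hl hlV
  have i1 := integrable_comp_inv_smul_sub_mul hf hfc hl hfR (hψV.mono_set hlV)
  have i2 := integrable_comp_inv_smul_sub_mul hf hfc hl hfR (hgV.mono_set hlV)
  rw [mul_left_comm, ← mul_add, ← integral_const_mul, ← integral_add]
  · congr 1
    refine integral_congr_ae (ae_of_all _ fun y => ?_)
    ring
  · refine (i2.sub (i1.const_mul q)).congr (ae_of_all _ fun y => ?_)
    simp only [Pi.sub_apply]
    ring
  · exact i1.const_mul _

end Differentiation

/-- A line is determined by the integrals of compactly supported functions against its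
one-dimensional Hausdorff measure. -/
theorem span_singleton_eq_of_setIntegral_eq {E : Type*} [NormedAddCommGroup E] [NormedSpace ℝ E]
    [FiniteDimensional ℝ E] [MeasurableSpace E] [BorelSpace E] {v w : E} (hv : v ≠ 0)
    (h : ∀ f : E → ℝ, Continuous f → HasCompactSupport f →
      ∫ y in (Submodule.span ℝ {v} : Set E), f y ∂(Measure.hausdorffMeasure 1) =
        ∫ y in (Submodule.span ℝ {w} : Set E), f y ∂(Measure.hausdorffMeasure 1)) :
    v ∈ Submodule.span ℝ {w} := by
  have : ProperSpace E := FiniteDimensional.proper ℝ E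
  by_contra hvw
  set e : E := ‖v‖⁻¹ • v with he
  have hnv : ‖v‖ ≠ 0 := norm_ne_zero_iff.2 hv
  have hne : ‖e‖ = 1 := by rw [he, norm_smul, norm_inv, norm_norm, inv_mul_cancel₀ hnv]
  have hspan : (Submodule.span ℝ {v} : Set E) = range fun t : ℝ => t • e := by
    rw [← Submodule.span_singleton_smul_eq (IsUnit.mk0 _ (inv_ne_zero hnv)) v]
    ext y
    simp [Submodule.mem_span_singleton, he]
  have hew : e ∉ (Submodule.span ℝ {w} : Set E) := fun hmem => hvw <| by
    have := Submodule.smul_mem (Submodule.span ℝ {w}) ‖v‖ hmem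
    rwa [he, smul_inv_smul₀ hnv] at this
  -- The line through `w` is closed and misses `e`, so a tent function around `e` sees only the line
  -- through `v`.
  obtain ⟨δ, hδ, hball⟩ := Metric.isOpen_iff.1
    (Submodule.closed_of_finiteDimensional (Submodule.span ℝ {w})).isOpen_compl e hew
  set f : E → ℝ := fun z => max 0 (δ - dist z e) with hf
  have hfc : Continuous f := by fun_prop
  have hfs : HasCompactSupport f :=
    HasCompactSupport.of_support_subset_isCompact (isCompact_closedBall e δ) fun z hz => by
      by_contra hlt
      rw [Metric.mem_closedBall, not_le] at hlt
      exact hz (max_eq_left (by linarith))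
  have hzero : ∫ y in (Submodule.span ℝ {w} : Set E), f y ∂(Measure.hausdorffMeasure 1) = 0 := by
    refine setIntegral_eq_zero_of_forall_eq_zero fun y hy => max_eq_left ?_
    by_contra! hlt
    exact hball (Metric.mem_ball.2 (by linarith)) hy
  -- The unit-speed parametrization turns `ℋ¹` on the line into Lebesgue measure.
  have hiso : Isometry fun t : ℝ => t • e := Isometry.of_dist_eq fun s t => by
    rw [dist_eq_norm, ← sub_smul, norm_smul, hne, mul_one, ← dist_eq_norm]
  have hpos : 0 < ∫ t : ℝ, f (t • e) := by
    refine Continuous.integral_pos_of_hasCompactSupport_nonneg_nonzero (x := 1) (by fun_prop)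
      (hfs.comp_isClosedEmbedding hiso.isClosedEmbedding) (fun t => le_max_left _ _) ?_
    simp [hf, hδ.le, hδ.ne']
  have hmap := hiso.map_hausdorffMeasure (d := 1) (Or.inl zero_le_one)
  rw [hausdorffMeasure_real] at hmap
  have h1 := h f hfc hfs
  rw [hzero, hspan, ← hmap, integral_map hiso.continuous.aemeasurable
    hfc.aestronglyMeasurable] at h1
  exact hpos.ne' h1

/-! ### Rectifiable vector densities -/

section Density

variable {m : ℕ} {U : Opens (EuclideanSpace ℝ (Fin m))}

theorem CountablyOneRectifiable.union {A B : Set (EuclideanSpace ℝ (Fin m))}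
    (hA : CountablyOneRectifiable A) (hB : CountablyOneRectifiable B) :
    CountablyOneRectifiable (A ∪ B) := by
  obtain ⟨A₀, F, hA₀, hF, hAF⟩ := hA
  obtain ⟨B₀, G, hB₀, hG, hBG⟩ := hB
  refine ⟨A₀ ∪ B₀, fun j => Sum.elim F G (Equiv.natSumNatEquivNat.symm j),
    measure_union_null hA₀ hB₀, fun j => ?_, ?_⟩
  · dsimp only
    rcases Equiv.natSumNatEquivNat.symm j with i | i
    exacts [hF i, hG i]
  · have hcov : ⋃ j, range (Sum.elim F G (Equiv.natSumNatEquivNat.symm j)) =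
        (⋃ j, range (F j)) ∪ ⋃ j, range (G j) := by
      rw [Equiv.natSumNatEquivNat.symm.surjective.iUnion_comp fun s => range (Sum.elim F G s),
        iUnion_sum]
      rfl
    rw [hcov, union_union_union_comm]
    exact union_subset_union hAF hBG

theorem CountablyOneRectifiable.mono {A B : Set (EuclideanSpace ℝ (Fin m))}
    (hB : CountablyOneRectifiable B) (hAB : A ⊆ B) : CountablyOneRectifiable A := by
  obtain ⟨B₀, G, hB₀, hG, hBG⟩ := hB
  exact ⟨B₀, G, hB₀, hG, hAB.trans hBG⟩

/-- The blow-ups at `x` of the measure with density `‖F‖` converge to `‖F x‖` times the length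
measure of the line spanned by `F x`. -/
def IsTangentDensityAt (F : EuclideanSpace ℝ (Fin m) → EuclideanSpace ℝ (Fin m))
    (x : EuclideanSpace ℝ (Fin m)) : Prop :=
  ∀ f : EuclideanSpace ℝ (Fin m) → ℝ, Continuous f → HasCompactSupport f →
    Tendsto (fun l : ℝ => l⁻¹ * ∫ y, f (l⁻¹ • (y - x)) * ‖F y‖ ∂(Measure.hausdorffMeasure 1))
      (𝓝[>] 0)
      (𝓝 (‖F x‖ * ∫ y in (Submodule.span ℝ {F x} : Set (EuclideanSpace ℝ (Fin m))),
        f y ∂(Measure.hausdorffMeasure 1)))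

/-- `F` is the vector density with respect to `ℋ¹` of a rectifiable `1`-current in `U`. -/
structure IsRectifiableDensity (U : Opens (EuclideanSpace ℝ (Fin m)))
    (F : EuclideanSpace ℝ (Fin m) → EuclideanSpace ℝ (Fin m)) : Prop where
  support_subset : Function.support F ⊆ U
  rectifiable : CountablyOneRectifiable (Function.support F)
  locallyIntegrableOn : LocallyIntegrableOn F U (Measure.hausdorffMeasure 1)
  tangent : ∀ᵐ x ∂(Measure.hausdorffMeasure 1 : Measure (EuclideanSpace ℝ (Fin m))),
    F x ≠ 0 → IsTangentDensityAt F x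

theorem IsRectifiableDensity.aestronglyMeasurable
    {F : EuclideanSpace ℝ (Fin m) → EuclideanSpace ℝ (Fin m)} (hF : IsRectifiableDensity U F) :
    AEStronglyMeasurable F (Measure.hausdorffMeasure 1) := by
  have h := hF.locallyIntegrableOn.aestronglyMeasurable
  rw [← aestronglyMeasurable_indicator_iff U.isOpen.measurableSet] at h
  rwa [indicator_eq_self.2 hF.support_subset] at h

theorem IsRectifiableDensity.nullMeasurableSet_support
    {F : EuclideanSpace ℝ (Fin m) → EuclideanSpace ℝ (Fin m)} (hF : IsRectifiableDensity U F) :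
    NullMeasurableSet (Function.support F) (Measure.hausdorffMeasure 1) := by
  rw [Function.support_eq_preimage]
  exact hF.aestronglyMeasurable.aemeasurable.nullMeasurableSet_preimage
    (measurableSet_singleton 0).compl

/-- Where `F` and `G` are both nonzero, the blow-ups of `‖F‖` converge along the line of `F` and
also, by differentiation relative to `‖G‖`, along that of `G`. So the lines agree, and `F + G`, if
nonzero, spans the same line. -/
theorem IsRectifiableDensity.ae_tangent_add
    {F G : EuclideanSpace ℝ (Fin m) → EuclideanSpace ℝ (Fin m)}
    (hF : IsRectifiableDensity U F) (hG : IsRectifiableDensity U G) :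
    ∀ᵐ x ∂(Measure.hausdorffMeasure 1 : Measure (EuclideanSpace ℝ (Fin m))),
      F x ≠ 0 → F x + G x ≠ 0 → IsTangentDensityAt (F + G) x := by
  have h1 := ae_tendsto_blowup_of_density U.isOpen hF.locallyIntegrableOn.norm
    (fun x => norm_nonneg _) (hF.locallyIntegrableOn.add hG.locallyIntegrableOn).norm
  have h2 := ae_tendsto_blowup_of_density U.isOpen hG.locallyIntegrableOn.norm
    (fun x => norm_nonneg _) hF.locallyIntegrableOn.norm
  filter_upwards [h1, h2, hF.tangent, hG.tangent] with x h1 h2 hFt hGt hFx hFGx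
  have hxU : x ∈ U := hF.support_subset hFx
  have hmem : G x ∈ Submodule.span ℝ {F x} := by
    by_cases hGx : G x = 0
    · rw [hGx]; exact zero_mem _
    refine span_singleton_eq_of_setIntegral_eq hGx fun f hf hfc => ?_
    have := tendsto_nhds_unique (hFt hFx f hf hfc)
      (h2 hxU (norm_pos_iff.2 hGx) (fun f => ∫ y in (Submodule.span ℝ {G x} :
        Set (EuclideanSpace ℝ (Fin m))), f y ∂(Measure.hausdorffMeasure 1)) (hGt hGx) f hf hfc)
    exact (mul_left_cancel₀ (norm_ne_zero_iff.2 hFx) this).symm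
  have hspan : Submodule.span ℝ {F x + G x} = Submodule.span ℝ {F x} := by
    obtain ⟨a, ha⟩ := Submodule.mem_span_singleton.1 hmem
    have hsum : F x + G x = (1 + a) • F x := by rw [add_smul, one_smul, ha]
    have ha0 : 1 + a ≠ 0 := fun h => hFGx (by rw [hsum, h, zero_smul])
    rw [hsum, Submodule.span_singleton_smul_eq (IsUnit.mk0 _ ha0)]
  intro f hf hfc
  simp only [Pi.add_apply]
  rw [hspan]
  exact h1 hxU (norm_pos_iff.2 hFx) (fun f => ∫ y in (Submodule.span ℝ {F x} :
    Set (EuclideanSpace ℝ (Fin m))), f y ∂(Measure.hausdorffMeasure 1)) (hFt hFx) f hf hfc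

theorem IsRectifiableDensity.add
    {F G : EuclideanSpace ℝ (Fin m) → EuclideanSpace ℝ (Fin m)}
    (hF : IsRectifiableDensity U F) (hG : IsRectifiableDensity U G) :
    IsRectifiableDensity U (F + G) where
  support_subset := (Function.support_add F G).trans
    (union_subset hF.support_subset hG.support_subset)
  rectifiable := (hF.rectifiable.union hG.rectifiable).mono (Function.support_add F G)
  locallyIntegrableOn := hF.locallyIntegrableOn.add hG.locallyIntegrableOn
  tangent := by
    filter_upwards [hF.ae_tangent_add hG, hG.ae_tangent_add hF] with x h1 h2 hx
    -- `ae_tangent_add` needs its first density nonzero at `x`; otherwise the roles are exchanged.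
    by_cases hFx : F x = 0
    · have hGx : G x ≠ 0 := fun h => hx (by simp [hFx, h])
      rw [add_comm F G]
      exact h2 hGx (by rwa [add_comm])
    · exact h1 hFx hx

theorem IsRectifiableDensity.integrable_apply
    {F : EuclideanSpace ℝ (Fin m) → EuclideanSpace ℝ (Fin m)} (hF : IsRectifiableDensity U F)
    (ω : 𝓓(U, EuclideanSpace ℝ (Fin m) →L[ℝ] ℝ)) :
    Integrable (fun x => ω x (F x)) (Measure.hausdorffMeasure 1) := by
  obtain ⟨C, hC⟩ := ω.continuous.bounded_above_of_compact_support ω.hasCompactSupport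
  have hi : IntegrableOn F (tsupport ω) (Measure.hausdorffMeasure 1) :=
    hF.locallyIntegrableOn.integrableOn_compact_subset ω.tsupport_subset
      ω.hasCompactSupport.isCompact
  have hm : AEStronglyMeasurable (fun x => ω x (F x)) (Measure.hausdorffMeasure 1) :=
    isBoundedBilinearMap_apply.continuous.comp_aestronglyMeasurable₂
      ω.continuous.aestronglyMeasurable hF.aestronglyMeasurable
  refine (integrableOn_iff_integrable_of_support_subset (s := tsupport ω) fun x hx => ?_).1 ?_
  · refine subset_tsupport ω fun h => hx ?_
    simp [h]
  · refine (hi.norm.const_mul C).mono' hm.restrict (ae_of_all _ fun x => ?_)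
    exact ((ω x).le_opNorm _).trans (by gcongr; exact hC x)

/-- Testing with the forms `g φ`, for a scalar test function `g` and a constant covector `φ`,
reduces this to the scalar-test-function criterion for vanishing on `U`; off `U` both densities are
zero. -/
theorem IsRectifiableDensity.ae_eq_of_forall_integral_eq
    {F G : EuclideanSpace ℝ (Fin m) → EuclideanSpace ℝ (Fin m)}
    (hF : IsRectifiableDensity U F) (hG : IsRectifiableDensity U G)
    (h : ∀ ω : 𝓓(U, EuclideanSpace ℝ (Fin m) →L[ℝ] ℝ),
      ∫ x, ω x (F x) ∂(Measure.hausdorffMeasure 1) =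
        ∫ x, ω x (G x) ∂(Measure.hausdorffMeasure 1)) :
    F =ᵐ[Measure.hausdorffMeasure 1] G := by
  have key : ∀ᵐ x ∂(Measure.hausdorffMeasure 1 : Measure (EuclideanSpace ℝ (Fin m))),
      x ∈ (U : Set (EuclideanSpace ℝ (Fin m))) → (F - G) x = 0 := by
    refine U.isOpen.ae_eq_zero_of_integral_contDiff_smul_eq_zero
      (hF.locallyIntegrableOn.sub hG.locallyIntegrableOn) fun g hg hgc hgU => ?_
    by_cases hint : Integrable (fun x => g x • (F - G) x)
      (Measure.hausdorffMeasure 1 : Measure (EuclideanSpace ℝ (Fin m)))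
    swap
    · exact integral_undef hint
    refine (SeparatingDual.eq_zero_iff_forall_dual_eq_zero (R := ℝ) _).2 fun φ => ?_
    let ω : 𝓓(U, EuclideanSpace ℝ (Fin m) →L[ℝ] ℝ) :=
      ⟨fun x => g x • φ, hg.smul contDiff_const, hgc.smul_right,
        (tsupport_smul_subset_left g fun _ => φ).trans hgU⟩
    have hω : ∀ x v, ω x v = g x * φ v := fun x v => rfl
    rw [← φ.integral_comp_comm hint]
    have e := sub_eq_zero.2 (h ω)
    rw [← integral_sub (hF.integrable_apply ω) (hG.integrable_apply ω)] at e
    rw [← e]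
    refine integral_congr_ae (ae_of_all _ fun x => ?_)
    simp [hω, mul_sub]
  filter_upwards [key] with x hx
  by_cases hxU : x ∈ (U : Set (EuclideanSpace ℝ (Fin m)))
  · exact sub_eq_zero.1 (hx hxU)
  · rw [Function.notMem_support.1 fun h => hxU (hF.support_subset h),
      Function.notMem_support.1 fun h => hxU (hG.support_subset h)]

end Density

/-! ### From triples to densities -/

namespace RectifiableTriple

variable {m : ℕ} {U : Opens (EuclideanSpace ℝ (Fin m))}

/-- The vector density `θ ξ` on `M`, extended by zero. -/
noncomputable def density (R : RectifiableTriple U) :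
    EuclideanSpace ℝ (Fin m) → EuclideanSpace ℝ (Fin m) :=
  R.M.indicator fun x => R.θ x • R.ξ x

theorem ae_norm_density (R : RectifiableTriple U) :
    (fun x => ‖R.density x‖) =ᵐ[Measure.hausdorffMeasure 1] R.M.indicator R.θ := by
  have h := R.tangent
  rw [ae_restrict_iff'₀ R.nullMeasurableSet] at h
  filter_upwards [h] with x hx
  by_cases hxM : x ∈ R.M
  · rw [density, indicator_of_mem hxM, indicator_of_mem hxM, norm_smul, (hx hxM).1, mul_one,
      Real.norm_of_nonneg (R.pos x hxM).le]
  · rw [density, indicator_of_notMem hxM, indicator_of_notMem hxM, norm_zero]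

theorem setIntegral_mul_eq (R : RectifiableTriple U) (f : EuclideanSpace ℝ (Fin m) → ℝ) :
    ∫ y in R.M, f y * R.θ y ∂(Measure.hausdorffMeasure 1) =
      ∫ y, f y * ‖R.density y‖ ∂(Measure.hausdorffMeasure 1) := by
  rw [← integral_indicator₀ R.nullMeasurableSet]
  refine integral_congr_ae ?_
  filter_upwards [R.ae_norm_density] with y hy
  rw [hy]
  by_cases hyM : y ∈ R.M <;> simp [hyM]

theorem aestronglyMeasurable_θ (R : RectifiableTriple U) :
    AEStronglyMeasurable R.θ ((Measure.hausdorffMeasure 1).restrict R.M) := by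
  have h := R.locallyIntegrableOn.aestronglyMeasurable
  rwa [Measure.restrict_restrict U.isOpen.measurableSet, inter_eq_right.2 R.subset] at h

theorem aestronglyMeasurable_density (R : RectifiableTriple U) :
    AEStronglyMeasurable R.density (Measure.hausdorffMeasure 1) := by
  rw [density, aestronglyMeasurable_indicator_iff₀ R.nullMeasurableSet]
  exact R.aestronglyMeasurable_θ.smul R.aemeasurable.aestronglyMeasurable

theorem isRectifiableDensity_density (R : RectifiableTriple U) :
    IsRectifiableDensity U R.density where
  support_subset := support_indicator_subset.trans R.subset
  rectifiable := R.rectifiable.mono support_indicator_subset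
  locallyIntegrableOn := by
    intro x hx
    obtain ⟨t, ht, hit⟩ := R.locallyIntegrableOn x hx
    obtain ⟨u, hu, hxu, hut⟩ := mem_nhdsWithin.1 ht
    have hm : MeasurableSet (u ∩ U) := hu.measurableSet.inter U.isOpen.measurableSet
    refine ⟨u ∩ U, inter_mem (mem_nhdsWithin_of_mem_nhds (hu.mem_nhds hxu)) self_mem_nhdsWithin, ?_⟩
    have h1 : IntegrableOn R.θ (u ∩ U) ((Measure.hausdorffMeasure 1).restrict R.M) :=
      hit.mono_set hut
    have h2 : IntegrableOn (R.M.indicator R.θ) (u ∩ U) (Measure.hausdorffMeasure 1) := by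
      refine IntegrableOn.integrable_indicator₀ ?_
        (R.nullMeasurableSet.mono_ac Measure.absolutelyContinuous_restrict)
      rwa [IntegrableOn, Measure.restrict_restrict₀ (R.nullMeasurableSet.mono_ac
        Measure.absolutelyContinuous_restrict), inter_comm, ← Measure.restrict_restrict hm]
    refine Integrable.mono h2 R.aestronglyMeasurable_density.restrict (ae_restrict_of_ae ?_)
    filter_upwards [R.ae_norm_density] with y hy
    rw [hy]
    exact le_abs_self _
  tangent := by
    have h := R.tangent
    rw [ae_restrict_iff'₀ R.nullMeasurableSet] at h
    filter_upwards [h, R.ae_norm_density] with x hx hnx hx0 f hf hfc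
    have hxM : x ∈ R.M := mem_of_indicator_ne_zero hx0
    have key := (hx hxM).2.2 f hf hfc
    have hd : R.density x = R.θ x • R.ξ x := indicator_of_mem hxM _
    rw [hnx, indicator_of_mem hxM, hd,
      Submodule.span_singleton_smul_eq (IsUnit.mk0 _ (R.pos x hxM).ne')]
    simpa only [R.setIntegral_mul_eq] using key

theorem represents_iff (R : RectifiableTriple U) (T : OneCurrent U) :
    R.Represents T ↔ ∀ ω : 𝓓(U, EuclideanSpace ℝ (Fin m) →L[ℝ] ℝ),
      T ω = ∫ x, ω x (R.density x) ∂(Measure.hausdorffMeasure 1) := by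
  refine forall_congr' fun ω => ?_
  rw [← integral_indicator₀ R.nullMeasurableSet]
  have : (R.M.indicator fun x => ω x (R.ξ x) * R.θ x) = fun x => ω x (R.density x) := by
    ext x
    by_cases hx : x ∈ R.M <;> simp [density, hx, mul_comm]
  rw [this]

/-- As `H(0) = 0`, the set `M` can be dropped, leaving an integral that depends only on the
almost-everywhere class of the density. -/
theorem cost_eq (R : RectifiableTriple U) (α c : ℝ) :
    R.cost α c = ENNReal.ofReal (c ^ α) *
      ∫⁻ x, ENNReal.ofReal (capacityH c α ‖R.density x‖) ∂(Measure.hausdorffMeasure 1) := by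
  rw [cost, ← lintegral_indicator₀ R.nullMeasurableSet]
  congr 1
  refine lintegral_congr_ae ?_
  filter_upwards [R.ae_norm_density] with x hx
  rw [hx]
  by_cases hxM : x ∈ R.M <;> simp [hxM, capacityH_zero]

theorem cost_eq_of_represents {R S : RectifiableTriple U} {T : OneCurrent U}
    (hR : R.Represents T) (hS : S.Represents T) (α c : ℝ) : R.cost α c = S.cost α c := by
  rw [represents_iff] at hR hS
  have h := R.isRectifiableDensity_density.ae_eq_of_forall_integral_eq
    S.isRectifiableDensity_density fun ω => (hR ω).symm.trans (hS ω)
  rw [cost_eq, cost_eq]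
  congr 1
  refine lintegral_congr_ae ?_
  filter_upwards [h] with x hx
  rw [hx]

theorem cost_eq_capacityCost {R : RectifiableTriple U} {T : OneCurrent U} (hR : R.Represents T)
    (α c : ℝ) : R.cost α c = capacityCost α c T :=
  le_antisymm (le_iInf₂ fun _ hS => (cost_eq_of_represents hR hS α c).le) (iInf₂_le R hR)

end RectifiableTriple

/-! ### From densities back to triples, and sums -/

/-- The triple `(supp F, ‖F‖, F / ‖F‖)` of a rectifiable density. -/
noncomputable def IsRectifiableDensity.toTriple {m : ℕ} {U : Opens (EuclideanSpace ℝ (Fin m))}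
    {F : EuclideanSpace ℝ (Fin m) → EuclideanSpace ℝ (Fin m)} (hF : IsRectifiableDensity U F) :
    RectifiableTriple U where
  M := Function.support F
  θ x := ‖F x‖
  ξ x := ‖F x‖⁻¹ • F x
  subset := hF.support_subset
  nullMeasurableSet := hF.nullMeasurableSet_support
  rectifiable := hF.rectifiable
  pos _ hx := norm_pos_iff.2 hx
  locallyIntegrableOn := hF.locallyIntegrableOn.norm.mono_measure Measure.restrict_le_self
  aemeasurable :=
    (hF.aestronglyMeasurable.norm.aemeasurable.inv.smul
      hF.aestronglyMeasurable.aemeasurable).restrict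
  tangent := by
    rw [ae_restrict_iff'₀ hF.nullMeasurableSet_support]
    filter_upwards [hF.tangent] with x hx hx0
    have hn : ‖F x‖ ≠ 0 := norm_ne_zero_iff.2 hx0
    have h1 : ‖‖F x‖⁻¹ • F x‖ = 1 := by rw [norm_smul, norm_inv, norm_norm, inv_mul_cancel₀ hn]
    refine ⟨h1, finrank_span_singleton (norm_ne_zero_iff.1 (by simp [h1])), fun f hf hfc => ?_⟩
    rw [Submodule.span_singleton_smul_eq (IsUnit.mk0 _ (inv_ne_zero hn))]
    refine (hx hx0 f hf hfc).congr fun l => ?_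
    rw [setIntegral_eq_integral_of_forall_compl_eq_zero]
    intro y hy
    simp [Function.notMem_support.1 hy]

theorem IsRectifiableDensity.density_toTriple {m : ℕ} {U : Opens (EuclideanSpace ℝ (Fin m))}
    {F : EuclideanSpace ℝ (Fin m) → EuclideanSpace ℝ (Fin m)} (hF : IsRectifiableDensity U F) :
    hF.toTriple.density = F := by
  ext1 x
  by_cases hx : F x = 0
  · rw [RectifiableTriple.density, indicator_of_notMem (show x ∉ hF.toTriple.M from fun h => h hx), hx]
  · rw [RectifiableTriple.density, indicator_of_mem (show x ∈ hF.toTriple.M from hx)]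
    exact smul_inv_smul₀ (norm_ne_zero_iff.2 hx) _

theorem RectifiableTriple.exists_represents_add {m : ℕ} {U : Opens (EuclideanSpace ℝ (Fin m))}
    {R S : RectifiableTriple U} {T₁ T₂ : OneCurrent U} (hR : R.Represents T₁)
    (hS : S.Represents T₂) :
    ∃ Q : RectifiableTriple U, Q.Represents (T₁ + T₂) ∧ Q.density = R.density + S.density := by
  have hF := R.isRectifiableDensity_density
  have hG := S.isRectifiableDensity_density
  refine ⟨(hF.add hG).toTriple, ?_, (hF.add hG).density_toTriple⟩
  rw [represents_iff] at hR hS ⊢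
  intro ω
  rw [(hF.add hG).density_toTriple, add_apply, hR ω, hS ω,
    ← integral_add (hF.integrable_apply ω) (hG.integrable_apply ω)]
  simp

/-- Opposite orientations may cancel, so the multiplicity of the sum is only bounded by the sum of
the multiplicities; monotonicity of `H` is therefore used before subadditivity. -/
theorem RectifiableTriple.cost_le_add {m : ℕ} {U : Opens (EuclideanSpace ℝ (Fin m))}
    {Q R S : RectifiableTriple U} (h : Q.density = R.density + S.density) {c α : ℝ} (hc : 0 < c)
    (hα : α ∈ Icc (0 : ℝ) 1) : Q.cost α c ≤ R.cost α c + S.cost α c := by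
  have hm : AEMeasurable (fun x => ENNReal.ofReal (capacityH c α ‖R.density x‖))
      (Measure.hausdorffMeasure 1) :=
    ((measurable_capacityH c α).comp_aemeasurable
      R.aestronglyMeasurable_density.norm.aemeasurable).ennreal_ofReal
  rw [cost_eq, cost_eq, cost_eq, ← mul_add, ← lintegral_add_left' hm, h]
  gcongr with x
  refine le_trans (ENNReal.ofReal_le_ofReal ?_) ENNReal.ofReal_add_le
  exact (capacityH_mono hc hα.1 (norm_add_le _ _)).trans (capacityH_add_le hα _ _)

/-- For `c > 0` and `α ∈ [0,1]`, the cost `𝐌_{α,c}` of a rectifiable `1`-current does not depend on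
the triple `(M, θ, ξ)` representing it, sums of rectifiable `1`-currents are rectifiable, and
`𝐌_{α,c}(T₁ + T₂) ≤ 𝐌_{α,c}(T₁) + 𝐌_{α,c}(T₂)`. -/
theorem mainTheorem7 (m : ℕ) (U : TopologicalSpace.Opens (EuclideanSpace ℝ (Fin m)))
    (c α : ℝ) (hc : 0 < c) (hα : α ∈ Set.Icc (0 : ℝ) 1) :
    (∀ (T : OneCurrent U) (R : RectifiableTriple U), R.Represents T →
      R.cost α c = capacityCost α c T) ∧
    ∀ T₁ T₂ : OneCurrent U, IsRectifiableCurrent T₁ → IsRectifiableCurrent T₂ →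
      IsRectifiableCurrent (T₁ + T₂) ∧
        capacityCost α c (T₁ + T₂) ≤ capacityCost α c T₁ + capacityCost α c T₂ := by
  refine ⟨fun T R hR => RectifiableTriple.cost_eq_capacityCost hR α c, ?_⟩
  rintro T₁ T₂ ⟨R, hR⟩ ⟨S, hS⟩
  obtain ⟨Q, hQ, hQd⟩ := RectifiableTriple.exists_represents_add hR hS
  refine ⟨⟨Q, hQ⟩, ?_⟩
  rw [← RectifiableTriple.cost_eq_capacityCost hQ, ← RectifiableTriple.cost_eq_capacityCost hR,
    ← RectifiableTriple.cost_eq_capacityCost hS]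
  exact RectifiableTriple.cost_le_add hQd hc hα
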